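/- Let $\mathbf K$ be a locally compact non-Archimedean field with non-trivial absolute value, let $\chi:\mathbf K\to\mathbf T=\{w\in\mathbb C:|w|=1\}$ be any fixed non-trivial continuous additive character of $\mathbf K$, and let $X$ be a Banach space over $\mathbf K$. Let $X^a$ be the algebraic dual of $X$, i.e. the space of all (not necessarily continuous) $\mathbf K$-linear functionals $f:X\to\mathbf K$, and let $\hat{\mathsf C}(X^a,X)$ be the cylindrical $\sigma$-algebra of $X^a$, generated by the sets $\{f\in X^a:(f(x_1),\dots,f(x_n))\in S\}$ with $n\in\mathbb N$, $x_1,\dots,x_n\in X$ and $S\subseteq\mathbf K^n$ Borel. **Theorem 2.27 (non-Archimedean analog of the Bochner–Kolmogorov theorem).** A function $\theta:X\to\mathbb C$ is the characteristic functional of a (real, countably additive) probability measure $\mu$ on $\hat{\mathsf C}(X^a,X)$, that is, $$\theta(x)=\int_{X^a}\chi(f(x))\,\mu(df)\qquad\text{for all }x\in X,$$ if and only if the following conditions all hold: 1. $\theta(0)=1$, $\theta$ is bounded, and $\sup_{x\in X}|\theta(x)|=1$; 2. $\theta$ is positive definite: $\sum_{i,j=1}^n c_i\overline{c_j}\,\theta(x_i-x_j)$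 is a non-negative real number for all $n$, all $x_1,\dots,x_n\in X$ and all $c_1,\dots,c_n\in\mathbb C$; 3. $\theta$ is pseudocontinuous: the restriction $\theta|_L$ is uniformly continuous for every finite-dimensional $\mathbf K$-linear subspace $L\subseteq X$. -/

import Mathlib

open MeasureTheory

noncomputable section

namespace NonArchBochner

/-- The algebra of cylinder subsets of a set `Y` determined by a family `Γ` of maps `Y → K`:
all sets `{y | (f₁ y, …, fₙ y) ∈ S}` with `fⱼ ∈ Γ` and `S` a Borel subset of `Kⁿ`. -/
def cylinderSets {Y K : Type*} [TopologicalSpace K] (Γ : Set (Y → K)) : Set (Set Y) :=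
  {C | ∃ (n : ℕ) (f : Fin n → Y → K) (S : Set (Fin n → K)),
    (∀ j, f j ∈ Γ) ∧ MeasurableSet[borel (Fin n → K)] S ∧ C = {y | (fun j => f j y) ∈ S}}

/-- The cylindrical σ-algebra on `Y` determined by `Γ`. -/
abbrev cylindricalSigmaAlgebra {Y K : Type*} [TopologicalSpace K] (Γ : Set (Y → K)) :
    MeasurableSpace Y :=
  MeasurableSpace.generateFrom (cylinderSets Γ)

section

variable (K X : Type*) [NontriviallyNormedField K] [NormedAddCommGroup X] [NormedSpace K X]

/-- The elements of `X`, regarded as the maps `f ↦ f x` on the algebraic dual of `X`. -/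
def evaluations : Set (Module.Dual K X → K) :=
  Set.range fun (x : X) (f : Module.Dual K X) => f x

/-- The cylindrical σ-algebra of the algebraic dual (all linear functionals, continuous or not),
determined by the evaluations at the elements of `X`. -/
abbrev dualCylindrical : MeasurableSpace (Module.Dual K X) :=
  cylindricalSigmaAlgebra (evaluations K X)

variable {K X}

/-- The characteristic functional (Fourier–Stieltjes transform with respect to the additive
character `χ` of `K`) of a measure on the algebraic dual of `X`:
`x ↦ ∫ χ (f x) μ(df)`. -/
def characteristicFunctional (χ : AddChar K Circle)
    (μ : @Measure (Module.Dual K X) (dualCylindrical K X)) (x : X) : ℂ :=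
  ∫ f, (χ (f x) : ℂ) ∂μ

end

/-- `∑ᵢ ∑ⱼ cᵢ c̄ⱼ θ (xᵢ - xⱼ)` is real and nonnegative for all finite families. -/
def IsPositiveDefinite {G : Type*} [AddGroup G] (θ : G → ℂ) : Prop :=
  ∀ (n : ℕ) (x : Fin n → G) (c : Fin n → ℂ),
    0 ≤ (∑ i, ∑ j, c i * (starRingEnd ℂ) (c j) * θ (x i - x j)).re ∧
      (∑ i, ∑ j, c i * (starRingEnd ℂ) (c j) * θ (x i - x j)).im = 0

/-- Uniform continuity of the restriction to every finite-dimensional linear subspace. -/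
def IsPseudocontinuous (K : Type*) {X : Type*} [NontriviallyNormedField K]
    [NormedAddCommGroup X] [NormedSpace K X] (θ : X → ℂ) : Prop :=
  ∀ L : Submodule K X, FiniteDimensional K L → UniformContinuous fun x : L => θ x

end NonArchBochner

end

/-!
The conditions on a characteristic functional `θ` are direct: positive definiteness is
`∑ c i * conj (c j) * θ (x i - x j) = ∫ |∑ c i * χ (f (x i))|²`, and pseudocontinuity is dominated
convergence, as every linear functional is continuous on finite-dimensional subspaces.

Conversely, a Hamel basis of `X` identifies the algebraic dual with the families of scalars indexed
by that basis, so a measure is constructed from its finite-dimensional marginals by Kolmogorov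
extension (`exists_isProjectiveLimit`). The marginals come from Bochner's theorem on `Kⁿ`
(`exists_measure_integral_dotChar_eq`), and they are consistent because the Fourier transform
determines a finite measure (`ext_of_integral_dotChar`).

Bochner's theorem on `Kⁿ` uses that balls are compact open subgroups. The quotient of a ball `U` by
the annihilator `W` of a large ball `P` is finite, and the double sum of `φ (a - b) χ (ξ ⬝ (b - a))`
over representatives `a`, `b` of this quotient is a nonnegative density on `P`. Orthogonality of
characters (`setIntegral_addChar_addSubgroup`) shows that its transform is an average of `φ` over
translates by elements of `W`, hence is close to `φ` on `U` (`exists_measure_norm_sub_le`). Averaging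
the transform over a small ball bounds the tails (`measureReal_compl_annihilator_le`), so the
approximating measures are tight and Prokhorov's theorem gives a limit measure, with transform `φ`.
-/

namespace NonArchBochner

open Filter Topology Metric IsUltrametricDist
open scoped BoundedContinuousFunction

/-! ### Orthogonality of characters -/

/-- Orthogonality of characters: the integral over a subgroup `B` of a character that is not
trivial on `B` vanishes. -/
theorem setIntegral_addChar_addSubgroup {G : Type*} [AddCommGroup G] [MeasurableSpace G]
    [MeasurableAdd G] (m : Measure G) [m.IsAddLeftInvariant] (B : AddSubgroup G)
    (hB : MeasurableSet (B : Set G)) (ψ : AddChar G Circle) [Decidable (∀ x ∈ B, ψ x = 1)] :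
    ∫ x in (B : Set G), (ψ x : ℂ) ∂m = if ∀ x ∈ B, ψ x = 1 then (m.real B : ℂ) else 0 := by
  split_ifs with h
  · rw [setIntegral_congr_fun (g := fun _ => (1 : ℂ)) hB fun x hx => by simp [h x hx]]
    simp
  · push Not at h
    obtain ⟨a, ha, hψ⟩ := h
    -- Translating by `a ∈ B` multiplies the integral by `ψ a ≠ 1`.
    have key : ∫ x in (B : Set G), (ψ x : ℂ) ∂m = ψ a * ∫ x in (B : Set G), (ψ x : ℂ) ∂m := by
      rw [← integral_const_mul, ← integral_indicator hB, ← integral_indicator hB,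
        ← integral_add_left_eq_self _ a]
      refine integral_congr_ae (.of_forall fun x => ?_)
      by_cases hx : x ∈ B
      · simp [Set.indicator, hx, B.add_mem ha hx, AddChar.map_add_eq_mul]
      · have : a + x ∉ B := fun h => hx ((B.add_mem_cancel_left ha).1 h)
        simp [Set.indicator, hx, this]
    have h1 : (1 - (ψ a : ℂ)) * ∫ x in (B : Set G), (ψ x : ℂ) ∂m = 0 := by
      rw [sub_mul, one_mul, sub_eq_zero]; exact key
    refine (mul_eq_zero.1 h1).resolve_left fun h0 => hψ ?_
    exact Circle.ext (by simpa using (sub_eq_zero.1 h0).symm)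

/-! ### The self-pairing of `Kⁿ` -/

section Pairing

variable {K ι : Type*} [Fintype ι]

section

variable [CommRing K]

/-- The additive character `ξ ↦ χ (∑ i, ξ i * x i)` of `ι → K`. -/
noncomputable def dotChar (χ : AddChar K Circle) (x : ι → K) : AddChar (ι → K) Circle where
  toFun ξ := χ (ξ ⬝ᵥ x)
  map_zero_eq_one' := by simp
  map_add_eq_mul' ξ η := by rw [add_dotProduct, AddChar.map_add_eq_mul]

theorem dotChar_apply (χ : AddChar K Circle) (x ξ : ι → K) : dotChar χ x ξ = χ (ξ ⬝ᵥ x) := rfl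

theorem dotChar_comm (χ : AddChar K Circle) (x ξ : ι → K) : dotChar χ x ξ = dotChar χ ξ x := by
  rw [dotChar_apply, dotChar_apply, dotProduct_comm]

theorem dotChar_add (χ : AddChar K Circle) (x y ξ : ι → K) :
    dotChar χ (x + y) ξ = dotChar χ x ξ * dotChar χ y ξ := by
  rw [dotChar_comm, AddChar.map_add_eq_mul, dotChar_comm, dotChar_comm χ ξ y]

theorem dotChar_neg (χ : AddChar K Circle) (x ξ : ι → K) :
    dotChar χ (-x) ξ = (dotChar χ x ξ)⁻¹ := by
  rw [dotChar_comm, AddChar.map_neg_eq_inv, dotChar_comm]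

/-- The annihilator of a subgroup `B` of `ι → K` for the pairing `χ (∑ i, ξ i * x i)`. -/
def annihilator (χ : AddChar K Circle) (B : AddSubgroup (ι → K)) : AddSubgroup (ι → K) where
  carrier := {ξ | ∀ x ∈ B, dotChar χ x ξ = 1}
  zero_mem' x _ := AddChar.map_zero_eq_one _
  add_mem' hξ hη x hx := by rw [AddChar.map_add_eq_mul, hξ x hx, hη x hx, one_mul]
  neg_mem' hξ x hx := by rw [AddChar.map_neg_eq_inv, hξ x hx, inv_one]

theorem mem_annihilator {χ : AddChar K Circle} {B : AddSubgroup (ι → K)} {ξ : ι → K} :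
    ξ ∈ annihilator χ B ↔ ∀ x ∈ B, dotChar χ x ξ = 1 := Iff.rfl

end

variable [NontriviallyNormedField K]

theorem continuous_dotChar {χ : AddChar K Circle} (hχ : Continuous χ) :
    Continuous fun p : (ι → K) × (ι → K) => (dotChar χ p.1 p.2 : ℂ) := by
  simp only [dotChar_apply, dotProduct]
  fun_prop

/-- The closed ball of radius `r > 0` around `0`, as a subgroup. -/
abbrev ball (V : Type*) [SeminormedAddCommGroup V] [IsUltrametricDist V] {r : ℝ} (hr : 0 < r) :
    AddSubgroup V :=
  (closedBall_openAddSubgroup V hr).toAddSubgroup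

theorem mem_ball {V : Type*} [SeminormedAddCommGroup V] [IsUltrametricDist V] {r : ℝ} {hr : 0 < r}
    {x : V} : x ∈ ball V hr ↔ ‖x‖ ≤ r :=
  mem_closedBall_zero_iff

theorem coe_ball (V : Type*) [SeminormedAddCommGroup V] [IsUltrametricDist V] {r : ℝ}
    (hr : 0 < r) : (ball V hr : Set V) = closedBall 0 r := rfl

variable [IsUltrametricDist K]

/-- The circle has no small subgroups, so `χ` is trivial on a ball: on a ball where `χ` is within
`1 / 2` of `1` its integral is not zero, so orthogonality forces `χ` to be trivial there. -/
theorem exists_ball_addChar_eq_one [LocallyCompactSpace K] {χ : AddChar K Circle}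
    (hχ : Continuous χ) : ∃ δ > 0, ∀ t : K, ‖t‖ ≤ δ → χ t = 1 := by
  classical
  borelize K
  have : ProperSpace K := .of_locallyCompactSpace K
  have hc : ContinuousAt (fun t => (χ t : ℂ)) 0 := by fun_prop
  obtain ⟨ε, hε, h⟩ := Metric.continuousAt_iff.1 hc (1 / 2) (by norm_num)
  have hr : 0 < ε / 2 := by positivity
  refine ⟨ε / 2, hr, ?_⟩
  by_contra! hne
  let m : Measure K := Measure.addHaar
  have h0 := setIntegral_addChar_addSubgroup m (ball K hr) (by
    rw [coe_ball]; exact isClosed_closedBall.measurableSet) χ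
  rw [if_neg fun h1 => by
    obtain ⟨t, ht, hχt⟩ := hne
    exact hχt (h1 t (mem_ball.2 ht)), coe_ball] at h0
  have hfin : m (closedBall (0 : K) (ε / 2)) < ⊤ := measure_closedBall_lt_top
  have hpos : 0 < m.real (closedBall (0 : K) (ε / 2)) :=
    ENNReal.toReal_pos (measure_closedBall_pos m _ hr).ne' hfin.ne
  have hb : ‖∫ t in closedBall (0 : K) (ε / 2), ((χ t : ℂ) - 1) ∂m‖ ≤
      1 / 2 * m.real (closedBall (0 : K) (ε / 2)) := by
    refine norm_setIntegral_le_of_norm_le_const hfin fun t ht => ?_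
    have : dist t 0 < ε := (mem_closedBall.1 ht).trans_lt (by linarith)
    simpa [dist_eq_norm] using (h this).le
  have hi : IntegrableOn (fun t => (χ t : ℂ)) (closedBall (0 : K) (ε / 2)) m :=
    (by fun_prop : Continuous fun t => (χ t : ℂ)).continuousOn.integrableOn_compact
      (isCompact_closedBall _ _)
  rw [integral_sub hi (integrableOn_const hfin.ne), h0] at hb
  simp only [integral_const, zero_sub, norm_neg] at hb
  simp only [measureReal_restrict_apply_univ, mul_one, Complex.real_smul, Complex.norm_real,
    Real.norm_of_nonneg hpos.le] at hb
  linarith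

/-- The annihilator of a ball is open, because `χ` is trivial near `0`. -/
theorem isOpen_annihilator_ball [LocallyCompactSpace K] {χ : AddChar K Circle} (hχ : Continuous χ)
    {r : ℝ} (hr : 0 < r) : IsOpen (annihilator χ (ball (ι → K) hr) : Set (ι → K)) := by
  obtain ⟨δ, hδ, h⟩ := exists_ball_addChar_eq_one hχ
  refine AddSubgroup.isOpen_of_mem_nhds _
    (mem_of_superset (closedBall_mem_nhds 0 (div_pos hδ hr)) fun ξ hξ x hx => h _ ?_)
  rw [mem_closedBall_zero_iff] at hξ
  rw [mem_ball] at hx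
  refine mem_ball.1 ((ball K hδ).sum_mem fun i _ => mem_ball.2 ?_)
  calc ‖ξ i * x i‖ = ‖ξ i‖ * ‖x i‖ := norm_mul _ _
    _ ≤ δ / r * r := by
      gcongr
      exacts [(norm_le_pi_norm ξ i).trans hξ, (norm_le_pi_norm x i).trans hx]
    _ = δ := by field_simp

/-- Annihilators of large balls are small: if `χ t ≠ 1`, the ball of radius `‖t‖ / r` contains the
annihilator of the ball of radius `r`. -/
theorem exists_annihilator_ball_norm_le (ι : Type*) [Fintype ι] {χ : AddChar K Circle}
    (hχ1 : χ ≠ 1) :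
    ∃ T > 0, ∀ (r : ℝ) (hr : 0 < r), ∀ ξ ∈ annihilator χ (ball (ι → K) hr), ‖ξ‖ ≤ T / r := by
  classical
  obtain ⟨t, ht⟩ := (AddChar.ne_one_iff).1 hχ1
  have ht0 : t ≠ 0 := by rintro rfl; exact ht χ.map_zero_eq_one
  refine ⟨‖t‖, norm_pos_iff.2 ht0, fun r hr ξ hξ => (pi_norm_le_iff_of_nonneg (by positivity)).2
    fun i => ?_⟩
  by_contra! hi
  have hi0 : ξ i ≠ 0 := norm_pos_iff.1 (lt_trans (by positivity) hi)
  refine ht ?_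
  have := hξ (Pi.single i (t / ξ i)) (mem_ball.2 ?_)
  · rwa [dotChar_apply, dotProduct_single, mul_div_cancel₀ _ hi0] at this
  · rw [Pi.norm_single, norm_div, div_le_iff₀ (norm_pos_iff.2 hi0)]
    rw [div_lt_iff₀ hr] at hi
    linarith

end Pairing

/-! ### Approximation by transforms of measures on balls -/

/-- Positive definiteness for families indexed by any finite type. -/
theorem IsPositiveDefinite.fintype {G : Type*} [AddGroup G] {θ : G → ℂ}
    (hθ : IsPositiveDefinite θ) {α : Type*} [Fintype α] (x : α → G) (c : α → ℂ) :
    0 ≤ (∑ i, ∑ j, c i * (starRingEnd ℂ) (c j) * θ (x i - x j)).re ∧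
      (∑ i, ∑ j, c i * (starRingEnd ℂ) (c j) * θ (x i - x j)).im = 0 := by
  let e := Fintype.equivFin α
  have hs : ∑ i, ∑ j, c i * (starRingEnd ℂ) (c j) * θ (x i - x j) =
      ∑ i, ∑ j, c (e.symm i) * (starRingEnd ℂ) (c (e.symm j)) *
        θ (x (e.symm i) - x (e.symm j)) := by
    rw [← e.symm.sum_comp]
    exact Finset.sum_congr rfl fun i _ => (e.symm.sum_comp _).symm
  rw [hs]
  exact hθ _ (x ∘ e.symm) (c ∘ e.symm)

section Approximation

variable {K ι : Type*} [Fintype ι] [NontriviallyNormedField K] [IsUltrametricDist K]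
  [LocallyCompactSpace K] [MeasurableSpace (ι → K)] [BorelSpace (ι → K)]

/-- Bochner's theorem on a ball of `Kⁿ`, up to `ε`. With `U` the ball of radius `ρ`, `P` a large ball
with annihilator `W` and `s` a system of representatives of the finite group `A = U ⧸ W`, the density
`p ξ = (|A| m(P))⁻¹ ∑ a b, φ (s a - s b) χ (ξ ⬝ (s b - s a))` on `P` is nonnegative because `φ` is
positive definite. By orthogonality on `P`, its transform at `u ∈ U` is the average over `b` of
values of `φ` at points of `u + W`; it is exactly `φ 0` at `u = 0`. -/
theorem exists_measure_norm_sub_le {χ : AddChar K Circle} (hχ : Continuous χ) (hχ1 : χ ≠ 1)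
    {φ : (ι → K) → ℂ} (hφ0 : φ 0 = 1) (hφ : IsPositiveDefinite φ) (hφc : UniformContinuous φ)
    {ρ ε : ℝ} (hρ : 0 < ρ) (hε : 0 < ε) :
    ∃ ν : Measure (ι → K), IsProbabilityMeasure ν ∧
      ∀ x, ‖x‖ ≤ ρ → ‖φ x - ∫ ξ, (dotChar χ x ξ : ℂ) ∂ν‖ ≤ ε := by
  classical
  have : ProperSpace K := .of_locallyCompactSpace K
  obtain ⟨η, hη, hηε⟩ := Metric.uniformContinuous_iff.1 hφc ε hε
  -- The radius `2 T / η` of `P` makes `W` lie in the ball of radius `η / 2`.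
  obtain ⟨T, hT, hTb⟩ := exists_annihilator_ball_norm_le ι hχ1
  have hR : 0 < 2 * T / η := by positivity
  let m : Measure (ι → K) := Measure.addHaar
  let P : AddSubgroup (ι → K) := ball (ι → K) hR
  let W : AddSubgroup (ι → K) := annihilator χ P
  have hWη : ∀ x ∈ W, ‖x‖ < η := fun x hx => (hTb _ hR x hx).trans_lt (by
    have : T / (2 * T / η) = η / 2 := by field_simp
    linarith)
  let U : AddSubgroup (ι → K) := ball (ι → K) hρ
  have hUc : IsCompact (U : Set (ι → K)) := isCompact_closedBall _ _
  have hPc : IsCompact (P : Set (ι → K)) := isCompact_closedBall _ _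
  have hPm : MeasurableSet (P : Set (ι → K)) := hPc.isClosed.measurableSet
  have : CompactSpace U := isCompact_iff_compactSpace.1 hUc
  let A := U ⧸ W.addSubgroupOf U
  have : Finite A := AddSubgroup.quotient_finite_of_isOpen _
    ((isOpen_annihilator_ball hχ hR).preimage continuous_subtype_val)
  have := Fintype.ofFinite A
  let s : A → ι → K := fun a => (Quotient.out a : U)
  have hsU : ∀ a, s a ∈ U := fun a => (Quotient.out a : U).2
  -- Each coset of `W` in `U` is represented exactly once.
  have hs : ∀ a (u : U), s a - u ∈ W ↔ a = (u : A) := by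
    intro a u
    have : (a : A) = ((Quotient.out a : U) : A) := (Quotient.out_eq' a).symm
    rw [this, eq_comm, QuotientAddGroup.eq, AddSubgroup.mem_addSubgroupOf, sub_eq_neg_add]
    simp [s]
  have hfin : m P < ⊤ := hPc.measure_lt_top
  have hM : 0 < m.real P :=
    ENNReal.toReal_pos (measure_closedBall_pos m _ hR).ne' hfin.ne
  have hN : 0 < (Fintype.card A : ℝ) := by exact_mod_cast Fintype.card_pos
  let C : ℝ := (Fintype.card A * m.real P)⁻¹
  have hC : 0 < C := by positivity
  let p : (ι → K) → ℂ := fun ξ =>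
    C * ∑ a, ∑ b, φ (s a - s b) * (dotChar χ (s b - s a) ξ : ℂ)
  have hp : ∀ ξ, 0 ≤ (p ξ).re ∧ (p ξ).im = 0 := by
    intro ξ
    have h := hφ.fintype s fun a => (dotChar χ (-s a) ξ : ℂ)
    have e : ∑ a, ∑ b, (dotChar χ (-s a) ξ : ℂ) * (starRingEnd ℂ) (dotChar χ (-s b) ξ : ℂ) *
        φ (s a - s b) = ∑ a, ∑ b, φ (s a - s b) * (dotChar χ (s b - s a) ξ : ℂ) := by
      refine Finset.sum_congr rfl fun a _ => Finset.sum_congr rfl fun b _ => ?_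
      rw [← Circle.coe_inv_eq_conj, ← dotChar_neg, neg_neg, sub_eq_add_neg (s b), dotChar_add]
      push_cast
      ring
    rw [e] at h
    exact ⟨by rw [Complex.re_ofReal_mul]; exact mul_nonneg hC.le h.1,
      by rw [Complex.im_ofReal_mul, h.2, mul_zero]⟩
  have hpre : ∀ ξ, ((p ξ).re : ℂ) = p ξ := fun ξ =>
    Complex.ext (by simp) (by simp [(hp ξ).2])
  have hcont : ∀ x : ι → K, Continuous fun ξ => (dotChar χ x ξ : ℂ) := fun x =>
    (continuous_dotChar hχ).comp (Continuous.prodMk_right x)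
  have hpc : Continuous p := by
    refine continuous_const.mul (continuous_finsetSum _ fun a _ => continuous_finsetSum _
      fun b _ => continuous_const.mul (hcont _))
  -- The Fourier transform of `p` on `U` averages `φ` over differences of representatives.
  have hint : ∀ u : U, ∫ ξ in (P : Set (ι → K)), p ξ * (dotChar χ u ξ : ℂ) ∂m =
      (Fintype.card A : ℂ)⁻¹ * ∑ b, φ (s (((⟨s b, hsU b⟩ + u : U)) : A) - s b) := by
    intro u
    have h1 : ∀ ξ, p ξ * (dotChar χ u ξ : ℂ) =
        ∑ a, ∑ b, C * φ (s a - s b) * (dotChar χ (s b - s a + (u : ι → K)) ξ : ℂ) := by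
      intro ξ
      simp only [p, Finset.mul_sum, Finset.sum_mul, dotChar_add]
      refine Finset.sum_congr rfl fun a _ => Finset.sum_congr rfl fun b _ => ?_
      push_cast
      ring
    have hio : ∀ a b, IntegrableOn
        (fun ξ => C * φ (s a - s b) * (dotChar χ (s b - s a + (u : ι → K)) ξ : ℂ)) P m := fun a b =>
      (continuous_const.mul (hcont _)).continuousOn.integrableOn_compact hPc
    simp_rw [h1]
    rw [integral_finsetSum _ fun a _ => integrable_finsetSum _ fun b _ => hio a b]
    simp_rw [integral_finsetSum _ fun b _ => hio _ b]
    rw [Finset.sum_comm, Finset.mul_sum]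
    refine Finset.sum_congr rfl fun b _ => ?_
    have h2 : ∀ a, ∫ ξ in (P : Set (ι → K)),
        C * φ (s a - s b) * (dotChar χ (s b - s a + (u : ι → K)) ξ : ℂ) ∂m =
        if a = ((⟨s b, hsU b⟩ + u : U) : A) then
          (Fintype.card A : ℂ)⁻¹ * φ (s (((⟨s b, hsU b⟩ + u : U)) : A) - s b) else 0 := by
      intro a
      rw [integral_const_mul, setIntegral_addChar_addSubgroup m P hPm]
      have hiff : (∀ ξ ∈ P, dotChar χ (s b - s a + (u : ι → K)) ξ = 1) ↔
          a = ((⟨s b, hsU b⟩ + u : U) : A) := by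
        rw [← hs, ← W.neg_mem_iff, mem_annihilator]
        have : -(s a - ((⟨s b, hsU b⟩ + u : U) : ι → K)) = s b - s a + (u : ι → K) := by
          push_cast; abel
        rw [this]
        exact forall₂_congr fun ξ _ => by rw [dotChar_comm]
      simp only [hiff]
      split_ifs with h
      · rw [← h]
        have : (m.real P : ℂ) ≠ 0 := by exact_mod_cast hM.ne'
        simp only [C]
        push_cast
        field_simp
      · simp
    rw [Finset.sum_congr rfl fun a _ => h2 a, Finset.sum_ite_eq', if_pos (Finset.mem_univ _)]
  let ν := (m.restrict P).withDensity fun ξ => ENNReal.ofReal (p ξ).re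
  have hν : ∀ f : (ι → K) → ℂ, ∫ ξ, f ξ ∂ν = ∫ ξ in (P : Set (ι → K)), p ξ * f ξ ∂m := by
    intro f
    rw [integral_withDensity_eq_integral_toReal_smul (by fun_prop) (by simp)]
    refine integral_congr_ae (.of_forall fun ξ => ?_)
    simp only [ENNReal.toReal_ofReal (hp ξ).1, Complex.real_smul, hpre]
  have hpi : IntegrableOn (fun ξ => (p ξ).re) P m :=
    (Complex.continuous_re.comp hpc).continuousOn.integrableOn_compact hPc
  have hν1 : IsProbabilityMeasure ν := by
    constructor
    rw [withDensity_apply _ MeasurableSet.univ, Measure.restrict_univ,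
      ← ofReal_integral_eq_lintegral_ofReal hpi (.of_forall fun ξ => (hp ξ).1)]
    have h0 := hint 0
    have hself : ∀ b, (((⟨s b, hsU b⟩ + 0 : U)) : A) = b := fun b => by
      rw [add_zero, eq_comm, ← hs]; simp
    simp only [hself, sub_self, hφ0, Finset.sum_const, Finset.card_univ, nsmul_eq_mul, mul_one]
      at h0
    rw [inv_mul_cancel₀ (by exact_mod_cast hN.ne')] at h0
    have h3 : ((∫ ξ in (P : Set (ι → K)), (p ξ).re ∂m : ℝ) : ℂ) = 1 := by
      rw [← h0, ← integral_complex_ofReal]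
      refine integral_congr_ae (.of_forall fun ξ => ?_)
      simp [hpre, dotChar_apply]
    rw [Complex.ofReal_eq_one.1 h3, ENNReal.ofReal_one]
  refine ⟨ν, hν1, fun x hx => ?_⟩
  rw [hν, hint ⟨x, mem_ball.2 hx⟩]
  have hx1 : φ x = (Fintype.card A : ℂ)⁻¹ * ∑ b : A, φ x := by
    rw [Finset.sum_const, Finset.card_univ, nsmul_eq_mul, inv_mul_cancel_left₀]
    exact_mod_cast hN.ne'
  rw [hx1, ← mul_sub, ← Finset.sum_sub_distrib, norm_mul, norm_inv, Complex.norm_natCast,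
    inv_mul_le_iff₀ hN]
  suffices h : ∀ b, ‖φ x - φ (s (((⟨s b, hsU b⟩ + ⟨x, mem_ball.2 hx⟩ : U)) : A) - s b)‖ ≤ ε by
    refine (norm_sum_le_of_le Finset.univ fun b _ => h b).trans ?_
    rw [Finset.sum_const, Finset.card_univ, nsmul_eq_mul]
  intro b
  rw [← dist_eq_norm, dist_comm]
  refine (hηε ?_).le
  rw [dist_eq_norm]
  have := hWη _ ((hs _ _).2 (rfl : _ = (((⟨s b, hsU b⟩ + ⟨x, mem_ball.2 hx⟩ : U)) : A)))
  refine lt_of_eq_of_lt (congrArg _ ?_) this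
  push_cast
  abel

end Approximation

/-! ### Uniqueness and Bochner's theorem on `Kⁿ` -/

section FiniteDimensional

variable {K ι : Type*} [Fintype ι] [NontriviallyNormedField K]

/-- The character `ξ ↦ χ (∑ i, ξ i * x i)` as a bounded continuous function. -/
noncomputable def dotCharBCF {χ : AddChar K Circle} (hχ : Continuous χ) (x : ι → K) :
    (ι → K) →ᵇ ℂ :=
  .ofNormedAddCommGroup (fun ξ => (dotChar χ x ξ : ℂ))
    ((continuous_dotChar hχ).comp (Continuous.prodMk_right x)) 1 fun ξ =>
      (Circle.norm_coe (dotChar χ x ξ)).le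

theorem dotCharBCF_apply {χ : AddChar K Circle} (hχ : Continuous χ) (x ξ : ι → K) :
    dotCharBCF hχ x ξ = dotChar χ x ξ := rfl

/-- The trigonometric polynomials: the linear span of the characters of `ι → K`. -/
noncomputable def trigPolynomials (ι : Type*) [Fintype ι] {χ : AddChar K Circle}
    (hχ : Continuous χ) : StarSubalgebra ℂ ((ι → K) →ᵇ ℂ) where
  toSubalgebra := (Submodule.span ℂ (Set.range (dotCharBCF (ι := ι) hχ))).toSubalgebra
    (Submodule.subset_span ⟨0, by ext; simp [dotCharBCF_apply, dotChar_apply]⟩)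
    (fun f g hf hg => by
      have h := Submodule.mul_mem_mul hf hg
      rw [Submodule.span_mul_span] at h
      refine Submodule.span_mono ?_ h
      rintro _ ⟨_, ⟨x, rfl⟩, _, ⟨y, rfl⟩, rfl⟩
      exact ⟨x + y, by ext; simp [dotCharBCF_apply, dotChar_add]⟩)
  star_mem' {f} hf := by
    change star f ∈ Submodule.span ℂ (Set.range (dotCharBCF (ι := ι) hχ))
    change f ∈ Submodule.span ℂ (Set.range (dotCharBCF (ι := ι) hχ)) at hf
    induction hf using Submodule.span_induction with
    | mem f hf =>
      obtain ⟨x, rfl⟩ := hf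
      refine Submodule.subset_span ⟨-x, ?_⟩
      ext ξ
      rw [dotCharBCF_apply, dotChar_neg, Circle.coe_inv_eq_conj]
      rfl
    | zero => simp
    | add f g _ _ hf hg => rw [star_add]; exact Submodule.add_mem _ hf hg
    | smul c f _ hf => rw [star_smul]; exact Submodule.smul_mem _ _ hf

theorem trigPolynomials_separatesPoints {χ : AddChar K Circle} (hχ : Continuous χ) (hχ1 : χ ≠ 1) :
    ((trigPolynomials ι hχ).map
      (BoundedContinuousFunction.toContinuousMapStarₐ ℂ)).SeparatesPoints := by
  classical
  intro ξ η hne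
  obtain ⟨t, ht⟩ := AddChar.ne_one_iff.1 hχ1
  obtain ⟨i, hi⟩ := Function.ne_iff.1 hne
  let x : ι → K := Pi.single i (t / (ξ i - η i))
  refine ⟨dotCharBCF hχ x, ⟨dotCharBCF hχ x,
    ⟨dotCharBCF hχ x, Submodule.subset_span ⟨x, rfl⟩, rfl⟩, rfl⟩, fun h => ht ?_⟩
  have h1 : dotChar χ x ξ = dotChar χ x η := Circle.ext h
  have h2 : dotChar χ x (ξ - η) = 1 := by
    rw [AddChar.map_sub_eq_div, h1, div_self']
  rwa [dotChar_apply, dotProduct_single, Pi.sub_apply, mul_div_cancel₀ _ (sub_ne_zero.2 hi)] at h2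

variable [LocallyCompactSpace K] [MeasurableSpace (ι → K)] [BorelSpace (ι → K)]

theorem integrable_dotChar {χ : AddChar K Circle} (hχ : Continuous χ) (x : ι → K)
    (P : Measure (ι → K)) [IsFiniteMeasure P] : Integrable (fun ξ => (dotChar χ x ξ : ℂ)) P :=
  have : ProperSpace K := .of_locallyCompactSpace K
  (dotCharBCF hχ x).integrable P

/-- A finite measure on `Kⁿ` is determined by its Fourier transform: trigonometric polynomials
separate points, so the Stone–Weierstrass theorem applies. -/
theorem ext_of_integral_dotChar {χ : AddChar K Circle} (hχ : Continuous χ) (hχ1 : χ ≠ 1)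
    {P P' : Measure (ι → K)} [IsFiniteMeasure P] [IsFiniteMeasure P']
    (h : ∀ x, ∫ ξ, (dotChar χ x ξ : ℂ) ∂P = ∫ ξ, (dotChar χ x ξ : ℂ) ∂P') : P = P' := by
  have : ProperSpace K := .of_locallyCompactSpace K
  refine ext_of_forall_mem_subalgebra_integral_eq_of_pseudoEMetric_complete_countable
    (trigPolynomials_separatesPoints hχ hχ1) fun f hf => ?_
  change f ∈ Submodule.span ℂ (Set.range (dotCharBCF (ι := ι) hχ)) at hf
  induction hf using Submodule.span_induction with
  | mem f hf => obtain ⟨x, rfl⟩ := hf; exact h x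
  | zero => simp
  | add f g _ _ hf hg =>
    simp only [BoundedContinuousFunction.add_apply]
    rw [integral_add (f.integrable P) (g.integrable P),
      integral_add (f.integrable P') (g.integrable P'), hf, hg]
  | smul c f _ hf =>
    simp only [BoundedContinuousFunction.smul_apply]
    rw [integral_smul, integral_smul, hf]

variable [IsUltrametricDist K]

/-- Tail estimate: the mass outside the annihilator of a ball `B` is the average of
`1 - ∫ χ (ξ ⬝ x) dν` over `x ∈ B`. -/
theorem measureReal_compl_annihilator_le {χ : AddChar K Circle} (hχ : Continuous χ)
    (ν : Measure (ι → K)) [IsProbabilityMeasure ν] {r ε : ℝ} (hr : 0 < r)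
    (h : ∀ x, ‖x‖ ≤ r → ‖1 - ∫ ξ, (dotChar χ x ξ : ℂ) ∂ν‖ ≤ ε) :
    ν.real (annihilator χ (ball (ι → K) hr) : Set (ι → K))ᶜ ≤ ε := by
  classical
  have : ProperSpace K := .of_locallyCompactSpace K
  let m : Measure (ι → K) := Measure.addHaar
  let B : AddSubgroup (ι → K) := ball (ι → K) hr
  let N : AddSubgroup (ι → K) := annihilator χ B
  have hBc : IsCompact (B : Set (ι → K)) := isCompact_closedBall _ _
  have hBm : MeasurableSet (B : Set (ι → K)) := hBc.isClosed.measurableSet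
  have hNm : MeasurableSet (N : Set (ι → K)) := (isOpen_annihilator_ball hχ hr).measurableSet
  have hfin : m B < ⊤ := hBc.measure_lt_top
  have hM : 0 < m.real B := ENNReal.toReal_pos (measure_closedBall_pos m _ hr).ne' hfin.ne
  have : IsFiniteMeasure (m.restrict B) := ⟨by simpa using hfin⟩
  have hi : Integrable (Function.uncurry fun x ξ : ι → K => (dotChar χ x ξ : ℂ))
      ((m.restrict B).prod ν) :=
    Integrable.of_bound (continuous_dotChar hχ).aestronglyMeasurable 1
      (.of_forall fun p => (Circle.norm_coe (dotChar χ p.1 p.2)).le)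
  have hswap : ∫ x in (B : Set (ι → K)), ∫ ξ, (dotChar χ x ξ : ℂ) ∂ν ∂m =
      m.real B * ν.real N := by
    rw [integral_integral_swap hi]
    have h1 : ∀ ξ, ∫ x in (B : Set (ι → K)), (dotChar χ x ξ : ℂ) ∂m =
        (N : Set (ι → K)).indicator (fun _ => (m.real B : ℂ)) ξ := by
      intro ξ
      simp_rw [fun x => dotChar_comm χ x ξ]
      rw [setIntegral_addChar_addSubgroup m B hBm, Set.indicator]
      refine if_congr ?_ rfl rfl
      exact forall₂_congr fun x _ => by rw [dotChar_comm]
    simp_rw [h1]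
    rw [integral_indicator hNm, setIntegral_const]
    simp [mul_comm]
  have hb : ‖∫ x in (B : Set (ι → K)), (1 - ∫ ξ, (dotChar χ x ξ : ℂ) ∂ν) ∂m‖ ≤ ε * m.real B :=
    norm_setIntegral_le_of_norm_le_const hfin fun x hx => h x (mem_ball.1 hx)
  have hi' : IntegrableOn (fun x => ∫ ξ, (dotChar χ x ξ : ℂ) ∂ν) B m := hi.integral_prod_left
  rw [integral_sub (integrable_const _) hi', hswap] at hb
  have e : ∫ _ in (B : Set (ι → K)), (1 : ℂ) ∂m - m.real B * ν.real N =
      ((m.real B * (1 - ν.real N) : ℝ) : ℂ) := by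
    simp [mul_sub]
  rw [e, Complex.norm_real, mul_comm] at hb
  rw [probReal_compl_eq_one_sub hNm]
  exact le_of_mul_le_mul_right ((le_abs_self _).trans hb) hM

/-- Bochner's theorem on `Kⁿ`: the approximating measures are tight by the tail estimate, and any
limit point given by Prokhorov's theorem has transform `φ`. -/
theorem exists_measure_integral_dotChar_eq {χ : AddChar K Circle} (hχ : Continuous χ)
    (hχ1 : χ ≠ 1) {φ : (ι → K) → ℂ} (hφ0 : φ 0 = 1) (hφ : IsPositiveDefinite φ)
    (hφc : UniformContinuous φ) :
    ∃ ν : Measure (ι → K), IsProbabilityMeasure ν ∧ ∀ x, ∫ ξ, (dotChar χ x ξ : ℂ) ∂ν = φ x := by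
  have : ProperSpace K := .of_locallyCompactSpace K
  obtain ⟨T, hT, hTb⟩ := exists_annihilator_ball_norm_le ι hχ1
  choose ν hν1 hν using fun n : ℕ => exists_measure_norm_sub_le hχ hχ1 hφ0 hφ hφc
    (ρ := n + 1) (ε := 1 / (n + 1)) (by positivity) Nat.one_div_pos_of_nat
  -- The tail estimate only applies for large `n`, which is why tightness is shown with `limsup`.
  have htight : IsTightMeasureSet (Set.range ν) := by
    refine isTightMeasureSet_range_of_tendsto_limsup_measure_norm_gt
      (ENNReal.tendsto_atTop_zero.2 fun ε hε => ?_)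
    obtain ⟨e, he0, heε⟩ := ENNReal.lt_iff_exists_nnreal_btwn.1 hε
    have he : (0 : ℝ) < e := by exact_mod_cast he0
    obtain ⟨δ, hδ, hφδ⟩ := Metric.continuousAt_iff.1 hφc.continuous.continuousAt (e / 2 : ℝ)
      (by positivity)
    refine ⟨T / (δ / 2), fun R hR => limsup_le_of_le (by isBoundedDefault) ?_⟩
    have h1 : ∀ᶠ n : ℕ in atTop, (1 / ((n : ℝ) + 1)) < e / 2 :=
      tendsto_one_div_add_atTop_nhds_zero_nat.eventually_lt_const (by positivity)
    have h2 : ∀ᶠ n : ℕ in atTop, δ / 2 ≤ (n : ℝ) :=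
      tendsto_natCast_atTop_atTop.eventually_ge_atTop _
    filter_upwards [h1, h2] with n hn1 hn2
    have := hν1 n
    have hδ2 : 0 < δ / 2 := by positivity
    have hle := measureReal_compl_annihilator_le hχ (ν n) hδ2 (ε := e) fun x hx => by
      have h3 : ‖1 - φ x‖ < e / 2 := by
        rw [← hφ0, ← dist_eq_norm, dist_comm]
        exact hφδ (by rw [dist_zero_right]; linarith)
      have h4 := hν n x (by linarith)
      calc ‖1 - ∫ ξ, (dotChar χ x ξ : ℂ) ∂ν n‖
          ≤ ‖1 - φ x‖ + ‖φ x - ∫ ξ, (dotChar χ x ξ : ℂ) ∂ν n‖ :=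
            norm_sub_le_norm_sub_add_norm_sub _ _ _
        _ ≤ e := by linarith
    refine le_trans ?_ heε.le
    calc ν n {ξ | R < ‖ξ‖}
        ≤ ν n (annihilator χ (ball (ι → K) hδ2) : Set (ι → K))ᶜ :=
          measure_mono fun ξ hξ hmem => (hξ.trans_le (hTb _ hδ2 ξ hmem)).not_ge hR
      _ = ENNReal.ofReal ((ν n).real (annihilator χ (ball (ι → K) hδ2) : Set (ι → K))ᶜ) :=
          (ofReal_measureReal).symm
      _ ≤ ENNReal.ofReal e := ENNReal.ofReal_le_ofReal hle
      _ = e := ENNReal.ofReal_coe_nnreal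
  let p : ℕ → ProbabilityMeasure (ι → K) := fun n => ⟨ν n, hν1 n⟩
  have hcomp : IsCompact (closure (Set.range p)) := by
    refine isCompact_closure_of_isTightMeasureSet ?_
    convert! htight using 1
    ext μ
    constructor
    · rintro ⟨_, ⟨n, rfl⟩, rfl⟩
      exact ⟨n, rfl⟩
    · rintro ⟨n, rfl⟩
      exact ⟨p n, ⟨n, rfl⟩, rfl⟩
  -- A limit point of the approximations along an ultrafilter has transform `φ`.
  obtain ⟨μ, -, hμ⟩ := hcomp.ultrafilter_le_nhds ((hyperfilter ℕ).map p)
    (le_principal_iff.2 (mem_map.2 (univ_mem' fun n => subset_closure ⟨n, rfl⟩)))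
  refine ⟨μ, μ.2, fun x => ?_⟩
  have hlim : Tendsto p (hyperfilter ℕ) (𝓝 μ) := hμ
  rw [ProbabilityMeasure.tendsto_iff_forall_integral_rclike_tendsto ℂ] at hlim
  refine tendsto_nhds_unique (hlim (dotCharBCF hχ x)) ?_
  refine Tendsto.mono_left ?_ Nat.hyperfilter_le_atTop
  rw [tendsto_iff_norm_sub_tendsto_zero]
  refine squeeze_zero' (.of_forall fun _ => norm_nonneg _) ?_
    tendsto_one_div_add_atTop_nhds_zero_nat
  filter_upwards [tendsto_natCast_atTop_atTop.eventually_ge_atTop ‖x‖] with n hn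
  rw [norm_sub_rev]
  exact hν n x (by linarith)

end FiniteDimensional

/-! ### Kolmogorov extension -/

section Kolmogorov

variable {ι : Type*} {α : ι → Type*} [∀ i, TopologicalSpace (α i)]

/-- Cylinders over compact sets have the countable intersection property, although they are not
compact themselves: Tychonoff's theorem applies to the coordinates they constrain. -/
theorem nonempty_iInter_cylinder [∀ i, T2Space (α i)] [∀ i, Nonempty (α i)] (I : ℕ → Finset ι)
    (C : ∀ n, Set (∀ i : I n, α i)) (hC : ∀ n, IsCompact (C n))
    (h : ∀ n, (⋂ k ≤ n, cylinder (I k) (C k)).Nonempty) :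
    (⋂ n, cylinder (I n) (C n)).Nonempty := by
  classical
  choose x hx using h
  simp only [Set.mem_iInter, mem_cylinder] at hx
  -- Every coordinate that is constrained by some `C n` is confined to a compact set.
  have hQ : ∀ i, ∃ Q : Set (α i), IsCompact Q ∧ Q.Nonempty ∧
      ∀ n, (∃ k ≤ n, i ∈ I k) → x n i ∈ Q := by
    intro i
    by_cases hi : ∃ k, i ∈ I k
    · let k := Nat.find hi
      have hk : i ∈ I k := Nat.find_spec hi
      refine ⟨(fun y : ∀ j : I k, α j => y ⟨i, hk⟩) '' C k, (hC k).image (continuous_apply _),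
        ⟨_, _, hx k k le_rfl, rfl⟩, fun n ⟨l, hln, hl⟩ => ⟨_, hx n k ?_, rfl⟩⟩
      exact (Nat.find_min' hi hl).trans hln
    · obtain ⟨a⟩ := ‹∀ i, Nonempty (α i)› i
      exact ⟨{a}, isCompact_singleton, ⟨a, rfl⟩, fun n ⟨k, _, hk⟩ => absurd ⟨k, hk⟩ hi⟩
  choose Q hQc hQn hQx using hQ
  choose a ha using hQn
  let y : ℕ → ∀ i, α i := fun n i => if ∃ k ≤ n, i ∈ I k then x n i else a i
  have hyQ : ∀ n, y n ∈ Set.univ.pi Q := by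
    intro n i _
    by_cases h : ∃ k ≤ n, i ∈ I k
    · simpa only [y, if_pos h] using hQx i n h
    · simpa only [y, if_neg h] using ha i
  have hyC : ∀ n, ∀ k ≤ n, (I k).restrict (y n) ∈ C k := by
    intro n k hk
    have : (I k).restrict (y n) = (I k).restrict (x n) := by
      funext i
      exact if_pos ⟨k, hk, i.2⟩
    rw [this]
    exact hx n k hk
  have hcl : ∀ k, IsClosed (cylinder (I k) (C k)) := fun k =>
    (hC k).isClosed.preimage (Finset.continuous_restrict _)
  obtain ⟨z, hz⟩ := IsCompact.nonempty_iInter_of_sequence_nonempty_isCompact_isClosed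
    (fun n => Set.univ.pi Q ∩ ⋂ k ≤ n, cylinder (I k) (C k))
    (fun n => Set.inter_subset_inter_right _
      (Set.biInter_mono (fun k (hk : k ≤ n) => hk.trans n.le_succ) fun _ _ => subset_rfl))
    (fun n => ⟨y n, hyQ n, by simpa using hyC n⟩)
    ((isCompact_univ_pi hQc).inter_right (isClosed_biInter fun k _ => hcl k))
    (fun n => (isCompact_univ_pi hQc).isClosed.inter (isClosed_biInter fun k _ => hcl k))
  exact ⟨z, Set.mem_iInter.2 fun n =>
    Set.mem_iInter₂.1 ((Set.mem_iInter.1 hz n).2) n le_rfl⟩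

variable [∀ i, PolishSpace (α i)] [∀ i, Nonempty (α i)] [∀ i, MeasurableSpace (α i)]
  [∀ i, BorelSpace (α i)] {P : ∀ J : Finset ι, Measure (∀ j : J, α j)}

/-- The content of a projective family of finite measures is continuous at `∅`, because measures on
Polish spaces are inner regular for compact sets. -/
theorem tendsto_projectiveFamilyContent_zero [∀ J, IsFiniteMeasure (P J)]
    (hP : IsProjectiveMeasureFamily P) {A : ℕ → Set (∀ i, α i)}
    (hA : ∀ n, A n ∈ measurableCylinders α) (hanti : Antitone A) (hempty : ⋂ n, A n = ∅) :
    Tendsto (fun n => projectiveFamilyContent hP (A n)) atTop (𝓝 0) := by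
  choose I S hS hAS using fun n => (mem_measurableCylinders _).1 (hA n)
  refine ENNReal.tendsto_atTop_zero.2 fun ε hε => ?_
  by_contra! hlarge
  have hlarge' : ∀ n, ε < projectiveFamilyContent hP (A n) := by
    intro n
    obtain ⟨k, hk, h⟩ := hlarge n
    exact h.trans_le (projectiveFamilyContent_mono hP (hA k) (hA n) (hanti hk))
  obtain ⟨δ, hδ, hδε⟩ := ENNReal.exists_pos_sum_of_countable' hε.ne' ℕ
  have hreg : ∀ n, ∃ C ⊆ S n, IsCompact C ∧ P (I n) (S n \ C) < δ n := fun n =>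
    (hS n).exists_isCompact_sdiff_lt (measure_ne_top _ _) (hδ n).ne'
  choose C hCS hC hCδ using hreg
  have hCm : ∀ n, MeasurableSet (C n) := fun n => (hC n).isClosed.measurableSet
  obtain ⟨z, hz⟩ := nonempty_iInter_cylinder I C hC fun n => by
    by_contra! hne
    -- Otherwise `A n` is covered by the sets `S k \ C k` with `k ≤ n`, of total mass below `ε`.
    have hcover : A n ⊆ ⋃ k ∈ Finset.range (n + 1), cylinder (I k) (S k \ C k) := by
      intro x hx
      have hx' : x ∉ ⋂ k ≤ n, cylinder (I k) (C k) := by simp [hne]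
      simp only [Set.mem_iInter, not_forall] at hx'
      obtain ⟨k, hk, hxk⟩ := hx'
      have := hanti hk hx
      rw [hAS k] at this
      exact Set.mem_biUnion (Finset.mem_coe.2 (Finset.mem_range_succ_iff.2 hk)) ⟨this, hxk⟩
    have hmem : ∀ k, cylinder (I k) (S k \ C k) ∈ measurableCylinders α := fun k =>
      cylinder_mem_measurableCylinders _ _ ((hS k).diff (hCm k))
    refine (hlarge' n).not_ge ?_
    calc projectiveFamilyContent hP (A n)
        ≤ projectiveFamilyContent hP (⋃ k ∈ Finset.range (n + 1), cylinder (I k) (S k \ C k)) :=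
          projectiveFamilyContent_mono hP (hA n)
            (isSetRing_measurableCylinders.biUnion_mem _ fun k _ => hmem k) hcover
      _ ≤ ∑ k ∈ Finset.range (n + 1), projectiveFamilyContent hP (cylinder (I k) (S k \ C k)) :=
          addContent_biUnion_le isSetRing_measurableCylinders fun k _ => hmem k
      _ ≤ ∑ k ∈ Finset.range (n + 1), δ k := by
          refine Finset.sum_le_sum fun k _ => ?_
          rw [projectiveFamilyContent_cylinder hP ((hS k).diff (hCm k))]
          exact (hCδ k).le
      _ ≤ ∑' k, δ k := ENNReal.sum_le_tsum _
      _ ≤ ε := hδε.le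
  have : z ∈ ⋂ n, A n := Set.mem_iInter.2 fun n => by
    rw [hAS n]
    exact hCS n (Set.mem_iInter.1 hz n)
  simp [hempty] at this

/-- The Kolmogorov extension theorem for Polish spaces. -/
theorem exists_isProjectiveLimit [∀ J, IsFiniteMeasure (P J)]
    (hP : IsProjectiveMeasureFamily P) : ∃ μ : Measure (∀ i, α i), IsProjectiveLimit μ P := by
  have hsub : (projectiveFamilyContent hP).IsSigmaSubadditive :=
    isSigmaSubadditive_of_addContent_iUnion_eq_tsum isSetRing_measurableCylinders
      fun f hf hU hd => addContent_iUnion_eq_sum_of_tendsto_zero isSetRing_measurableCylinders _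
        (fun _ _ => projectiveFamilyContent_ne_top hP)
        (fun _ hs ha he => tendsto_projectiveFamilyContent_zero hP hs ha he) hf hU hd
  refine ⟨(projectiveFamilyContent hP).measure isSetSemiring_measurableCylinders
    generateFrom_measurableCylinders.ge hsub, fun J => ?_⟩
  ext s hs
  rw [Measure.map_apply (Finset.measurable_restrict J) hs, ← cylinder, AddContent.measure_eq _ _
    generateFrom_measurableCylinders.symm _ (cylinder_mem_measurableCylinders J s hs)]
  exact projectiveFamilyContent_cylinder hP hs

end Kolmogorov

/-! ### The cylindrical σ-algebra of the algebraic dual -/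

section Dual

variable {K X : Type*} [NontriviallyNormedField K] [NormedAddCommGroup X] [NormedSpace K X]

theorem measurable_dual_apply (x : X) :
    @Measurable (Module.Dual K X) K (dualCylindrical K X) (borel K) fun f => f x := by
  intro S hS
  refine MeasurableSpace.measurableSet_generateFrom
    ⟨1, fun _ f => f x, (fun v => v 0) ⁻¹' S, fun _ => ⟨x, rfl⟩, ?_, rfl⟩
  borelize K
  borelize (Fin 1 → K)
  exact (continuous_apply 0).measurable hS

/-- A map into the algebraic dual is measurable for the cylindrical σ-algebra if all its evaluations
are. Second countability of `K` identifies the Borel σ-algebra of `Kⁿ` with the product one. -/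
theorem measurable_of_dual_apply [SecondCountableTopology K] {Ω : Type*} {mΩ : MeasurableSpace Ω}
    {T : Ω → Module.Dual K X} (h : ∀ x, @Measurable Ω K mΩ (borel K) fun ω => T ω x) :
    @Measurable Ω (Module.Dual K X) mΩ (dualCylindrical K X) T := by
  borelize K
  refine @measurable_generateFrom _ _ mΩ _ _ ?_
  rintro _ ⟨n, f, S, hf, hS, rfl⟩
  choose x hx using hf
  have hm : Measurable fun ω (j : Fin n) => T ω (x j) := measurable_pi_lambda _ fun j => h (x j)
  have e : (fun ω (j : Fin n) => T ω (x j)) = fun ω j => f j (T ω) := by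
    funext ω j
    exact congrFun (hx j) (T ω)
  rw [e] at hm
  have hb : MeasurableSpace.pi = borel (Fin n → K) := BorelSpace.measurable_eq
  rw [← hb] at hS
  exact hm hS

theorem measurable_addChar_dual_apply {χ : AddChar K Circle} (hχ : Continuous χ) (x : X) :
    @Measurable (Module.Dual K X) ℂ (dualCylindrical K X) _ fun f => (χ (f x) : ℂ) := by
  borelize K
  have : Measurable fun t : K => (χ t : ℂ) := (by fun_prop : Continuous _).measurable
  exact this.comp (measurable_dual_apply x)

/-! ### Properties of characteristic functionals -/

section Necessity

variable {χ : AddChar K Circle} {μ : @Measure (Module.Dual K X) (dualCylindrical K X)}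

theorem integrable_addChar_dual_apply (hχ : Continuous χ)
    (hμ : IsProbabilityMeasure μ) (x : X) :
    Integrable (fun f : Module.Dual K X => (χ (f x) : ℂ)) μ :=
  Integrable.of_bound (measurable_addChar_dual_apply hχ x).aestronglyMeasurable 1
    (.of_forall fun f => (Circle.norm_coe (χ (f x))).le)

theorem characteristicFunctional_zero (hμ : IsProbabilityMeasure μ) :
    characteristicFunctional χ μ 0 = 1 := by
  simp [characteristicFunctional]

theorem norm_characteristicFunctional_le (hμ : IsProbabilityMeasure μ) (x : X) :
    ‖characteristicFunctional χ μ x‖ ≤ 1 := by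
  have h := norm_integral_le_of_norm_le_const (μ := μ) (f := fun f => (χ (f x) : ℂ)) (C := 1)
    (.of_forall fun f => (Circle.norm_coe (χ (f x))).le)
  rwa [probReal_univ, mul_one] at h

/-- The quadratic form of `c` is the integral of `|∑ i, c i * χ (f (x i))|²`. -/
theorem isPositiveDefinite_characteristicFunctional (hχ : Continuous χ)
    (hμ : IsProbabilityMeasure μ) :
    IsPositiveDefinite (characteristicFunctional χ μ) := by
  let _ := dualCylindrical K X
  intro n x c
  have key : ∑ i, ∑ j, c i * (starRingEnd ℂ) (c j) * characteristicFunctional χ μ (x i - x j) =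
      ((∫ f, Complex.normSq (∑ i, c i * χ (f (x i))) ∂μ : ℝ) : ℂ) := by
    rw [← integral_complex_ofReal]
    have h1 : ∀ f : Module.Dual K X, (Complex.normSq (∑ i, c i * χ (f (x i))) : ℂ) =
        ∑ i, ∑ j, c i * (starRingEnd ℂ) (c j) * χ (f (x i - x j)) := by
      intro f
      rw [← Complex.mul_conj, map_sum, Finset.sum_mul_sum]
      refine Finset.sum_congr rfl fun i _ => Finset.sum_congr rfl fun j _ => ?_
      rw [map_mul, map_sub, sub_eq_add_neg, AddChar.map_add_eq_mul, AddChar.map_neg_eq_inv,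
        Circle.coe_mul, Circle.coe_inv_eq_conj]
      ring
    have hi : ∀ i j, Integrable (fun f : Module.Dual K X =>
        c i * (starRingEnd ℂ) (c j) * (χ (f (x i - x j)) : ℂ)) μ := fun i j =>
      (integrable_addChar_dual_apply hχ hμ _).const_mul _
    simp_rw [h1]
    rw [integral_finsetSum _ fun i _ => integrable_finsetSum _ fun j _ => hi i j]
    refine Finset.sum_congr rfl fun i _ => ?_
    rw [integral_finsetSum _ fun j _ => hi i j]
    refine Finset.sum_congr rfl fun j _ => ?_
    rw [integral_const_mul]
    rfl
  rw [key]
  exact ⟨by simpa using integral_nonneg fun f => Complex.normSq_nonneg _, Complex.ofReal_im _⟩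

/-- `|θ x - θ y| ≤ ∫ |χ (f (x - y)) - 1| μ(df)`, which tends to `0` as `x - y → 0` in a
finite-dimensional subspace, by dominated convergence. -/
theorem isPseudocontinuous_characteristicFunctional [CompleteSpace K]
    (hχ : Continuous χ)
    (hμ : IsProbabilityMeasure μ) :
    IsPseudocontinuous K (characteristicFunctional χ μ) := by
  let _ := dualCylindrical K X
  intro L hL
  have hlim : Tendsto (fun z : L => ∫ f : Module.Dual K X, ‖(χ (f z) : ℂ) - 1‖ ∂μ) (𝓝 0)
      (𝓝 0) := by
    have : (0 : ℝ) = ∫ f : Module.Dual K X, (0 : ℝ) ∂μ := by simp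
    rw [this]
    refine tendsto_integral_filter_of_dominated_convergence (fun _ => 2)
      (.of_forall fun z =>
        ((measurable_addChar_dual_apply hχ _).sub_const 1).norm.aestronglyMeasurable)
      (.of_forall fun z => .of_forall fun f => ?_) (integrable_const _) (.of_forall fun f => ?_)
    · rw [norm_norm]
      refine (norm_sub_le _ _).trans ?_
      rw [Circle.norm_coe, norm_one]
      norm_num
    · -- A linear functional is continuous on the finite-dimensional space `L`.
      have hf : Continuous fun z : L => f z :=
        LinearMap.continuous_of_finiteDimensional (f.comp L.subtype)
      have : Continuous fun z : L => ‖(χ (f z) : ℂ) - 1‖ :=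
        (((by fun_prop : Continuous fun t => (χ t : ℂ)).comp hf).sub continuous_const).norm
      simpa using this.tendsto 0
  refine Metric.uniformContinuous_iff.2 fun ε hε => ?_
  obtain ⟨δ, hδ, h⟩ := Metric.eventually_nhds_iff.1 (hlim.eventually_lt_const hε)
  refine ⟨δ, hδ, fun x y hxy => lt_of_le_of_lt ?_ (h (y := x - y) (by
     rwa [dist_zero_right, ← dist_eq_norm]))⟩
  rw [dist_eq_norm, characteristicFunctional, characteristicFunctional,
    ← integral_sub (integrable_addChar_dual_apply hχ hμ _) (integrable_addChar_dual_apply hχ hμ _)]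
  refine (norm_integral_le_integral_norm _).trans (le_of_eq ?_)
  refine integral_congr_ae (.of_forall fun f => ?_)
  have e : (χ (f x) : ℂ) = χ (f y) * χ (f (x - y : L)) := by
    rw [← Circle.coe_mul, ← AddChar.map_add_eq_mul, ← map_add]
    simp
  have e2 : (χ (f x) : ℂ) - χ (f y) = χ (f y) * (χ (f (x - y : L)) - 1) := by rw [e]; ring
  simp only [e2, norm_mul, Circle.norm_coe, one_mul]

end Necessity

/-! ### Construction of the measure -/

section Sufficiency

theorem uniformContinuous_comp_linearMap [CompleteSpace K] {ι : Type*} [Finite ι] {θ : X → ℂ}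
    (hθ : IsPseudocontinuous K θ) (T : (ι → K) →ₗ[K] X) : UniformContinuous fun x => θ (T x) := by
  have := (hθ (LinearMap.range T) inferInstance).comp
    (LinearMap.toContinuousLinearMap T.rangeRestrict).uniformContinuous
  exact this

theorem IsPositiveDefinite.comp_addMonoidHom {G H : Type*} [AddGroup G] [AddGroup H] {θ : H → ℂ}
    (hθ : IsPositiveDefinite θ) (T : G →+ H) : IsPositiveDefinite fun x => θ (T x) := by
  intro n x c
  simpa only [map_sub, Function.comp_apply] using hθ n (T ∘ x) c

variable [IsUltrametricDist K] [LocallyCompactSpace K]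

/-- A Hamel basis of `X` identifies the algebraic dual with the set of all families of scalars indexed
by the basis. Bochner's theorem gives the measures on the finite subfamilies, uniqueness makes them
consistent, and the Kolmogorov extension theorem glues them. -/
theorem exists_measure_characteristicFunctional_eq {χ : AddChar K Circle} (hχ : Continuous χ)
    (hχ1 : χ ≠ 1) {θ : X → ℂ} (hθ0 : θ 0 = 1) (hθ : IsPositiveDefinite θ)
    (hθc : IsPseudocontinuous K θ) :
    ∃ μ : @Measure (Module.Dual K X) (dualCylindrical K X),
      IsProbabilityMeasure μ ∧ θ = characteristicFunctional χ μ := by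
  classical
  have : ProperSpace K := .of_locallyCompactSpace K
  borelize K
  let b := Module.Basis.ofVectorSpace K X
  let T (J : Finset (Module.Basis.ofVectorSpaceIndex K X)) : (J → K) →ₗ[K] X :=
    Fintype.linearCombination K fun j : J => b j
  choose P hP1 hP using fun J => exists_measure_integral_dotChar_eq hχ hχ1
    (φ := fun x => θ (T J x)) (by simpa using hθ0) (hθ.comp_addMonoidHom (T J).toAddMonoidHom)
    (uniformContinuous_comp_linearMap hθc (T J))
  have hproj : IsProjectiveMeasureFamily (α := fun _ => K) P := by
    intro I J hJI
    let res : (I → K) → J → K := Finset.restrict₂ (π := fun _ => K) hJI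
    have hres : Measurable res := Finset.measurable_restrict₂ hJI
    have : IsProbabilityMeasure ((P I).map res) :=
      Measure.isProbabilityMeasure_map hres.aemeasurable
    change P J = (P I).map res
    refine ext_of_integral_dotChar hχ hχ1 fun x => ?_
    -- Extend `x` by zero from `J` to `I`.
    let x' : I → K := fun i => if h : i.1 ∈ J then x ⟨i, h⟩ else 0
    let e : J → I := fun j => ⟨j, hJI j.2⟩
    have he : Function.Injective e := fun i j h => Subtype.ext (congrArg (fun k : I => k.1) h)
    have hx'e : ∀ j, x' (e j) = x j := fun j => dif_pos j.2
    have hx'0 : ∀ i, i ∉ Set.range e → x' i = 0 := fun i hi =>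
      dif_neg fun h => hi ⟨⟨i, h⟩, rfl⟩
    have hT : T J x = T I x' := by
      simp only [T, Fintype.linearCombination_apply]
      exact Fintype.sum_of_injective e he _ _ (fun i hi => by rw [hx'0 i hi, zero_smul])
        fun j => by rw [hx'e]
    have hdot : ∀ ξ : I → K, dotChar χ x (res ξ) =
        dotChar χ x' ξ := by
      intro ξ
      rw [dotChar_apply, dotChar_apply]
      congr 1
      exact Fintype.sum_of_injective e he _ _ (fun i hi => by rw [hx'0 i hi, mul_zero])
        fun j => by rw [hx'e]; rfl
    rw [hP, integral_map hres.aemeasurable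
      (integrable_dotChar hχ x _).aestronglyMeasurable]
    simp_rw [hdot]
    rw [hP, hT]
  have : PolishSpace K := inferInstance
  obtain ⟨μ, hμ⟩ := exists_isProjectiveLimit (α := fun _ => K) hproj
  have hμ1 : IsProbabilityMeasure μ := hμ.isProbabilityMeasure
  let S : (Module.Basis.ofVectorSpaceIndex K X → K) → Module.Dual K X := fun g => b.constr K g
  have hS : ∀ g x, S g x = ∑ j ∈ (b.repr x).support, b.repr x j * g j := by
    intro g x
    simp only [S, Module.Basis.constr_apply, Finsupp.sum, smul_eq_mul]
  let _ : MeasurableSpace (Module.Dual K X) := dualCylindrical K X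
  have hSm : Measurable S := by
    refine measurable_of_dual_apply fun x => ?_
    simp_rw [hS]
    fun_prop
  refine ⟨μ.map S, Measure.isProbabilityMeasure_map hSm.aemeasurable, funext fun x => ?_⟩
  let J := (b.repr x).support
  let v : J → K := fun j => b.repr x j
  have hTv : T J v = x := by
    simp only [T, Fintype.linearCombination_apply, v]
    rw [Finset.sum_coe_sort J fun j => b.repr x j • b j]
    exact b.linearCombination_repr x
  have hdot : ∀ g, χ (S g x) = dotChar χ v (J.restrict g) := by
    intro g
    rw [hS, dotChar_apply, dotProduct, ← Finset.sum_coe_sort]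
    exact congrArg χ (Finset.sum_congr rfl fun j _ => mul_comm _ _)
  rw [characteristicFunctional, integral_map hSm.aemeasurable
    (measurable_addChar_dual_apply hχ x).aestronglyMeasurable]
  have hrestrict : ∫ ξ, (dotChar χ v ξ : ℂ) ∂P J = ∫ g, (dotChar χ v (J.restrict g) : ℂ) ∂μ := by
    rw [← hμ J]
    exact integral_map (Finset.measurable_restrict J).aemeasurable
      (integrable_dotChar hχ v _).aestronglyMeasurable
  simp_rw [hdot]
  rw [← hrestrict, hP, hTv]

end Sufficiency

end Dual

end NonArchBochner

theorem theorem2p27 {K X : Type*} [NontriviallyNormedField K] [IsUltrametricDist K]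
    [LocallyCompactSpace K] [NormedAddCommGroup X] [NormedSpace K X] [CompleteSpace X]
    (χ : AddChar K Circle) (hχ : Continuous χ) (hχ1 : χ ≠ 1) (θ : X → ℂ) :
    (∃ μ : @MeasureTheory.Measure (Module.Dual K X) (NonArchBochner.dualCylindrical K X),
        MeasureTheory.IsProbabilityMeasure μ ∧
          θ = NonArchBochner.characteristicFunctional χ μ) ↔
      θ 0 = 1 ∧ (∃ C : ℝ, ∀ x, ‖θ x‖ ≤ C) ∧ IsLUB (Set.range fun x => ‖θ x‖) 1 ∧
        NonArchBochner.IsPositiveDefinite θ ∧ NonArchBochner.IsPseudocontinuous K θ := by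
  have : ProperSpace K := .of_locallyCompactSpace K
  constructor
  · rintro ⟨μ, hμ, rfl⟩
    have h0 := NonArchBochner.characteristicFunctional_zero (χ := χ) hμ
    have h1 := NonArchBochner.norm_characteristicFunctional_le (χ := χ) hμ
    refine ⟨h0, ⟨1, h1⟩, ⟨?_, fun c hc => ?_⟩,
      NonArchBochner.isPositiveDefinite_characteristicFunctional hχ hμ,
      NonArchBochner.isPseudocontinuous_characteristicFunctional hχ hμ⟩
    · rintro _ ⟨x, rfl⟩
      exact h1 x
    · exact hc ⟨0, by simp [h0]⟩
  · rintro ⟨h0, -, -, hpd, hpc⟩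
    exact NonArchBochner.exists_measure_characteristicFunctional_eq hχ hχ1 h0 hpd hpc
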